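/- Let $q$ be an odd prime power with $q\equiv 1 \pmod 3$. For an $\mathbb F_q$-subspace $U$ of a $k$-dimensional $\mathbb F_{q^m}$-vector space $V$, the $\mathbb F_q$-linear set of rank $\dim_{\mathbb F_q}U$ defined by $U$ is the set of points $L_U=\{\langle u\rangle_{\mathbb F_{q^m}} : u\in U\setminus\{0\}\}$ of $\mathrm{PG}(V,\mathbb F_{q^m})=\mathrm{PG}(k-1,q^m)$. It is scattered if $\dim_{\mathbb F_q}(U\cap P)\le 1$ for every point $P$ (a one-dimensional $\mathbb F_{q^m}$-subspace of $V$), and maximum scattered if moreover $\dim_{\mathbb F_q}U=km/2$. A code with block lengths $n_1\ge\dots\ge n_t$ is an $\mathbb F_{q^m}$-subspace $C$ of $\mathbb F_{q^m}^{n_1}\oplus\dots\oplus\mathbb F_{q^m}^{n_t}$. Its minimum distance $d$ is the least value of $\sum_{i=1}^t\dim_{\mathbb F_q}\langle x_{i,1}-y_{i,1},\dots,x_{i,n_i}-y_{i,n_i}\rangle_{\mathbb F_q}$ over distinct $x,y\in C$. It is an $[(n_1,\dots,n_t),k]_{q^m/q}$ code if $\dim_{\mathbb F_{q^m}}C=k$,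 and it is MSRD (maximum sum-rank distance) if $|C|=q^{\,m\sum_{i=j}^t n_i-\max\{m,n_j\}\delta}$, where $j$ and $\delta$ are the integers with $d-1=\sum_{i=1}^{j-1}\min\{m,n_i\}+\delta$ and $0\le\delta\le\min\{m,n_j\}-1$. Theorem. (1) There exist $2(q-1)$ pairwise disjoint maximum scattered $\mathbb F_q$-linear sets, of rank $6$, in $\mathrm{PG}(2,q^4)$. (2) For every integer $r\ge 1$ there exist $2(q-1)$ pairwise disjoint maximum scattered $\mathbb F_q$-linear sets, of rank $6r$, in $\mathrm{PG}(3r-1,q^4)$. (3) For every integer $r\ge 1$ and every integer $t$ with $1\le t\le 2(q-1)$ (in particular for $t=2(q-1)>q-1$) there exists an MSRD $[(6r,\dots,6r),3r]_{q^4/q}$ code with $t$ blocks. -/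

import Mathlib

open Module

noncomputable section

/-! `F` is the field with `q` elements and `K` its extension of degree `m = finrank F K`. -/

section LinearSets

variable {F : Type*} (K : Type*) [Field F] [Field K] [Algebra F K]
variable {V : Type*} [AddCommGroup V] [Module K V] [Module F V] [IsScalarTower F K V]

/-- The `F`-linear set `L_U` of `PG(V, K)`: the points `⟨u⟩_K` with `u ∈ U`, `u ≠ 0`. -/
def linearSet (U : Submodule F V) : Set (Projectivization K V) :=
  {P | ∃ (u : V) (hu : u ≠ 0), u ∈ U ∧ P = Projectivization.mk K u hu}

/-- The weight of the point `P` in the linear set `L_U`: the `F`-dimension of `U ∩ P`. -/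
def pointWeight (U : Submodule F V) (P : Projectivization K V) : ℕ :=
  finrank F ↥(U ⊓ P.submodule.restrictScalars F)

/-- `L_U` is scattered: all points have weight at most one. -/
def IsScattered (U : Submodule F V) : Prop :=
  ∀ P : Projectivization K V, pointWeight K U P ≤ 1

/-- `L_U` is maximum scattered in `PG(V, K) = PG(k - 1, q ^ m)`: it is scattered and its rank
`n = dim_F U` attains the bound `n ≤ k m / 2`. -/
def IsMaximumScattered (U : Submodule F V) : Prop :=
  IsScattered K U ∧ 2 * finrank F U = finrank K V * finrank F K

end LinearSets

section SumRank

variable (F : Type*) {K : Type*} [Field F] [Field K] [Algebra F K]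

/-- The `F`-rank of a vector over `K`: the `F`-dimension of the span of its coordinates. -/
def vectorRank {n : ℕ} (v : Fin n → K) : ℕ :=
  finrank F (Submodule.span F (Set.range v))

/-- The sum-rank distance on `K ^ n_1 ⊕ ⋯ ⊕ K ^ n_t`. -/
def sumRankDist {t : ℕ} {n : Fin t → ℕ} (x y : ∀ i, Fin (n i) → K) : ℕ :=
  ∑ i, vectorRank F (x i - y i)

/-- `d` is the minimum sum-rank distance of the code `C`. -/
def IsMinSumRankDist {t : ℕ} {n : Fin t → ℕ} (C : Submodule K (∀ i, Fin (n i) → K))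
    (d : ℕ) : Prop :=
  IsLeast {e | ∃ x ∈ C, ∃ y ∈ C, x ≠ y ∧ sumRankDist F x y = e} d

/-- `C` is a maximum sum-rank distance code with block lengths `n_1 ≥ ⋯ ≥ n_t`.  If `d` is the
minimum distance and `d - 1 = ∑_{i < j} min(m, n_i) + δ` with `0 ≤ δ ≤ min(m, n_j) - 1`, the
Singleton-type bound `|C| ≤ q ^ (m ∑_{i ≥ j} n_i - max(m, n_j) δ)` is attained (the subtraction
in the exponent is written as a multiplication on the left). -/
def IsMSRD {t : ℕ} {n : Fin t → ℕ} (C : Submodule K (∀ i, Fin (n i) → K)) : Prop :=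
  Antitone n ∧ ∃ d : ℕ, IsMinSumRankDist F C d ∧ ∃ (j : Fin t) (δ : ℕ),
    d = ∑ i ∈ Finset.Iio j, min (finrank F K) (n i) + δ + 1 ∧
    δ < min (finrank F K) (n j) ∧
    Nat.card C * Nat.card F ^ (max (finrank F K) (n j) * δ) =
      Nat.card F ^ (finrank F K * ∑ i ∈ Finset.Ici j, n i)

end SumRank

end

/-! Let `M` be the quadratic intermediate field, `σ` a generator of the Galois group and `A` the
companion matrix of `X ^ 3 - w`, with `w` a non-cube of `F`; it exists because 3 divides `q - 1`.
For `θ ∉ M` let `U_θ` be the set of all `σ(x) + θ A x`, `x ∈ M ^ 3` (or `r` copies of this), of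
dimension `6r` over `F`. By `twisted_proportional`, if `l` times a nonzero vector of `U_θ` lies in
`U_θ'`, then `l = σ m` and `l θ = m θ'` with `m ∈ M`. For `θ' = θ` this gives `l ∈ F`, so `U_θ` is
scattered; for distinct translates `a + θ`, `b + θ` with `a, b ∈ M` it forces `l = 0`, so the linear
sets are disjoint. There are `q ^ 2 ≥ 2(q - 1)` translates. For the codes, evaluate `v ↦ v ⬝ h` on
bases of the trace-orthogonals of the `U_i`. Block `i` of the codeword of `h` has rank `4 - dim {l |
l h ∈ U_i}`, and for `h ≠ 0` these defects add up to at most 1. Hence `d = 4t - 1`, which meets the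
Singleton-type bound. -/

/-! ### Non-cubes and the quadratic subfield. -/

/-- The norm form of `X ^ 3 - w` is anisotropic if `w` is not a cube. -/
theorem cubicNormForm_anisotropic {F : Type*} [Field F] {w : F} (hw : ∀ z : F, z ^ 3 ≠ w)
    {a b c : F} (h : a ^ 3 + w * b ^ 3 + w ^ 2 * c ^ 3 - 3 * w * a * b * c = 0) :
    a = 0 ∧ b = 0 ∧ c = 0 := by
  have hw0 : w ≠ 0 := fun h0 => hw 0 (by simp [h0])
  by_cases hc : c = 0
  · subst hc
    by_cases hb : b = 0
    · subst hb
      exact ⟨pow_eq_zero_iff (n := 3) (by norm_num) |>.1 (by simpa using h), rfl, rfl⟩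
    · refine absurd ?_ (hw (-a / b))
      field_simp
      linear_combination -h
  · exfalso
    -- The remainder of `X ^ 3 - w` modulo `c X ^ 2 + b X + a` is, up to `c ^ 2`, `(b ^ 2 - a c) X +
    -- a b - w c ^ 2`. Its root, when the leading coefficient is nonzero, is the cube root used
    -- below.
    by_cases hr : b ^ 2 = a * c
    · have h1 : (b ^ 3 - w * c ^ 3) ^ 2 = 0 := by
        have e : a = b ^ 2 / c := by field_simp; exact hr.symm
        subst e
        field_simp at h
        linear_combination h
      have h2 : b ^ 3 - w * c ^ 3 = 0 := pow_eq_zero_iff (n := 2) (by norm_num) |>.1 h1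
      refine hw (b / c) ?_
      field_simp
      linear_combination h2
    · have hr' : b ^ 2 - a * c ≠ 0 := sub_ne_zero.2 hr
      refine hw ((w * c ^ 2 - a * b) / (b ^ 2 - a * c)) ?_
      rw [div_pow, div_eq_iff (pow_ne_zero 3 hr')]
      linear_combination (w * c ^ 3 - b ^ 3) * h

/-- A unit of order 3 prevents cubing from being injective, hence from being surjective. -/
theorem exists_not_cube {F : Type*} [Field F] [Finite F] (h : Nat.card F ≡ 1 [MOD 3]) :
    ∃ w : F, ∀ z : F, z ^ 3 ≠ w := by
  by_contra! hcube
  have hsurj : Function.Surjective (fun z : F => z ^ 3) := fun w => hcube w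
  have hinj := Finite.injective_iff_surjective.2 hsurj
  have : Fintype F := Fintype.ofFinite F
  have hdvd : 3 ∣ Nat.card Fˣ := by
    rw [Nat.card_units]
    exact (Nat.modEq_iff_dvd' Nat.card_pos).1 h.symm
  have : Fact (Nat.Prime 3) := ⟨Nat.prime_three⟩
  obtain ⟨u, hu⟩ := exists_prime_orderOf_dvd_card' 3 hdvd
  have h1 : (u : F) = 1 := hinj (by
    have := pow_orderOf_eq_one u
    rw [hu] at this
    simp [← Units.val_pow_eq_pow_val, this])
  have : u = 1 := Units.ext h1
  simp [this] at hu

/-- In the cyclic extension of degree four of a finite field there are a generator `σ` of the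
Galois group and the intermediate field `M` fixed by `σ ^ 2`. -/
theorem exists_generator_and_quadratic_subfield (F K : Type*) [Field F] [Finite F] [Field K]
    [Algebra F K] (hK : finrank F K = 4) :
    ∃ (σ : K ≃ₐ[F] K) (M : IntermediateField F K), finrank F M = 2 ∧ finrank M K = 2 ∧
      (∀ x ∈ M, σ x ∈ M ∧ σ (σ x) = x) ∧ ∀ x, σ x = x → ∃ c : F, algebraMap F K c = x := by
  have : FiniteDimensional F K := FiniteDimensional.of_finrank_pos (by omega)
  have : Finite K := Module.finite_of_finite F
  have : Fintype F := Fintype.ofFinite F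
  set σ : K ≃ₐ[F] K := FiniteField.frobeniusAlgEquivOfAlgebraic F K with hσ
  have hord : orderOf σ = 4 := by
    rw [hσ, FiniteField.orderOf_frobeniusAlgEquivOfAlgebraic, hK]
  set M := IntermediateField.fixedField (Subgroup.zpowers (σ ^ 2)) with hM
  have h2 : finrank M K = 2 := by
    rw [hM, IntermediateField.finrank_fixedField_eq_card, Nat.card_zpowers,
      orderOf_pow, hord]
    rfl
  have hmem : ∀ x, x ∈ M ↔ σ (σ x) = x := by
    intro x
    rw [hM, IntermediateField.mem_fixedField_iff]
    constructor
    · intro h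
      exact h (σ ^ 2) (Subgroup.mem_zpowers _)
    · intro h f hf
      have : Subgroup.zpowers (σ ^ 2) ≤ MulAction.stabilizer (K ≃ₐ[F] K) x :=
        (Subgroup.zpowers_le).2 h
      exact this hf
  refine ⟨σ, M, ?_, h2, fun x hx => ?_, fun x hx => ?_⟩
  · have := finrank_mul_finrank F M K
    rw [h2, hK] at this
    omega
  · have := (hmem x).1 hx
    exact ⟨(hmem _).2 (by rw [this]), this⟩
  · refine (IsGalois.mem_range_algebraMap_iff_fixed x).2 fun f => ?_
    obtain ⟨n, rfl⟩ := (FiniteField.bijective_frobeniusAlgEquivOfAlgebraic_pow F K).2 f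
    have : Subgroup.zpowers σ ≤ MulAction.stabilizer (K ≃ₐ[F] K) x := (Subgroup.zpowers_le).2 hx
    exact this (Subgroup.npow_mem_zpowers σ n)

/-! ### Proportional values of two twisted maps. -/

section Twisted

variable {F K : Type*} [Field F] [Field K] [Algebra F K]

theorem exists_eq_add_mul {M : IntermediateField F K} (hMK : finrank M K = 2) {θ : K}
    (hθ : θ ∉ M) (z : K) : ∃ a ∈ M, ∃ b ∈ M, z = a + b * θ := by
  have : FiniteDimensional M K := FiniteDimensional.of_finrank_pos (by omega)
  have hli : LinearIndependent M ![(1 : K), θ] := by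
    rw [LinearIndependent.pair_iff' one_ne_zero]
    intro a ha
    apply hθ
    rw [← ha, Algebra.smul_def, mul_one]
    exact a.2
  have hspan := hli.span_eq_top_of_card_eq_finrank' (by simp [hMK])
  have hz : z ∈ Submodule.span M (Set.range ![(1 : K), θ]) := by rw [hspan]; trivial
  rw [Matrix.range_cons, Matrix.range_cons, Matrix.range_empty, Set.union_empty,
    Set.singleton_union, Submodule.mem_span_pair] at hz
  obtain ⟨a, b, rfl⟩ := hz
  refine ⟨a, a.2, b, b.2, ?_⟩
  simp [Algebra.smul_def]

theorem eq_and_eq_of_add_mul_eq {M : IntermediateField F K} {θ : K} (hθ : θ ∉ M)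
    {a b c d : K} (ha : a ∈ M) (hb : b ∈ M) (hc : c ∈ M) (hd : d ∈ M)
    (h : a + b * θ = c + d * θ) : a = c ∧ b = d := by
  have hbd : b = d := by
    by_contra hne
    have hne' : b - d ≠ 0 := sub_ne_zero.2 hne
    apply hθ
    have : θ = (c - a) / (b - d) := by
      rw [eq_div_iff hne']
      linear_combination h
    rw [this]
    exact M.div_mem (M.sub_mem hc ha) (M.sub_mem hb hd)
  subst hbd
  exact ⟨add_right_cancel h, rfl⟩

/-- The key computation: proportionality of values of two twisted maps. -/
theorem twisted_proportional {σ : K ≃ₐ[F] K} {M : IntermediateField F K} (hMK : finrank M K = 2)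
    (hσ : ∀ x ∈ M, σ x ∈ M ∧ σ (σ x) = x)
    (hfix : ∀ x, σ x = x → ∃ c : F, algebraMap F K c = x)
    {w : F} (hw : ∀ z : F, z ^ 3 ≠ w) {θ θ' l : K} (hθ' : θ' ∉ M)
    {x y : Fin 3 → K} (hx : ∀ i, x i ∈ M) (hy : ∀ i, y i ∈ M) (hx0 : x ≠ 0)
    (h0 : σ (y 0) + algebraMap F K w * (θ' * y 2) =
      l * (σ (x 0) + algebraMap F K w * (θ * x 2)))
    (h1 : σ (y 1) + θ' * y 0 = l * (σ (x 1) + θ * x 0))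
    (h2 : σ (y 2) + θ' * y 1 = l * (σ (x 2) + θ * x 1)) :
    ∃ m ∈ M, l = σ m ∧ l * θ = m * θ' := by
  -- With `l = a + b θ'` and `l θ = c + d θ'`, comparing coefficients of `1, θ'` over `M` gives `σ y
  -- = a σ x + c A x` and `A y = b σ x + d A x`.
  obtain ⟨a, ha, b, hb, rfl⟩ := exists_eq_add_mul hMK hθ' l
  obtain ⟨c, hc, d, hd, hcd⟩ := exists_eq_add_mul hMK hθ' ((a + b * θ') * θ)
  have hwM : algebraMap F K w ∈ M := M.algebraMap_mem w
  have hw0 : algebraMap F K w ≠ 0 := by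
    rw [Ne, map_eq_zero]
    rintro rfl
    exact hw 0 (by simp)
  have hσw : σ (algebraMap F K w) = algebraMap F K w := σ.commutes w
  set W := algebraMap F K w with hW
  have mσ : ∀ {z}, z ∈ M → σ z ∈ M := fun hz => (hσ _ hz).1
  have add := fun {u v : K} (hu : u ∈ M) (hv : v ∈ M) => M.add_mem hu hv
  have mul := fun {u v : K} (hu : u ∈ M) (hv : v ∈ M) => M.mul_mem hu hv
  obtain ⟨e0, f0⟩ := eq_and_eq_of_add_mul_eq hθ' (mσ (hy 0)) (mul hwM (hy 2))
    (add (mul ha (mσ (hx 0))) (mul hwM (mul hc (hx 2))))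
    (add (mul hb (mσ (hx 0))) (mul hwM (mul hd (hx 2))))
    (by linear_combination h0 + W * x 2 * hcd)
  obtain ⟨e1, f1⟩ := eq_and_eq_of_add_mul_eq hθ' (mσ (hy 1)) (hy 0)
    (add (mul ha (mσ (hx 1))) (mul hc (hx 0)))
    (add (mul hb (mσ (hx 1))) (mul hd (hx 0)))
    (by linear_combination h1 + x 0 * hcd)
  obtain ⟨e2, f2⟩ := eq_and_eq_of_add_mul_eq hθ' (mσ (hy 2)) (hy 1)
    (add (mul ha (mσ (hx 2))) (mul hc (hx 1)))
    (add (mul hb (mσ (hx 2))) (mul hd (hx 1)))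
    (by linear_combination h2 + x 1 * hcd)
  have ss : ∀ {z}, z ∈ M → σ (σ z) = z := fun hz => (hσ _ hz).2
  -- Eliminate `y`.
  have f0' := congrArg σ f0
  have f1' := congrArg σ f1
  have f2' := congrArg σ f2
  simp only [map_add, map_mul, ss (hx 0), ss (hx 1), ss (hx 2), hσw] at f0' f1' f2'
  -- In matrix form: `(a - σ d) σ x = σ b A⁻¹ x - c A x`.
  have p0 : (a - σ d) * σ (x 0) = σ b * x 1 - W * c * x 2 := by
    linear_combination f1' - e0
  have p1 : (a - σ d) * σ (x 1) = σ b * x 2 - c * x 0 := by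
    linear_combination f2' - e1
  have p2 : W * (a - σ d) * σ (x 2) = σ b * x 0 - W * c * x 1 := by
    linear_combination f0' - W * e2
  have q0 := congrArg σ p0
  have q1 := congrArg σ p1
  have q2 := congrArg σ p2
  simp only [map_sub, map_mul, ss (hx 0), ss (hx 1), ss (hx 2), hσw, ss hb, ss hd]
    at q0 q1 q2
  -- Combining the relation with its conjugate removes `σ x`: the matrix `A - B 𝐀⁻² - C 𝐀²` kills
  -- `x`, where `𝐀` is the companion matrix and the scalars `A, B, C` lie in `F`. Since `𝐀⁻² = 𝐀 /
  -- w`, it belongs to the cubic field `F[𝐀]`.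
  obtain ⟨A, hA⟩ := hfix ((a - σ d) * (σ a - d) + b * c + σ b * σ c) (by
    simp only [map_add, map_sub, map_mul, ss ha, ss hb, ss hc, ss hd]
    ring)
  obtain ⟨B, hB⟩ := hfix (b * σ b) (by simp only [map_mul, ss hb]; ring)
  obtain ⟨C, hC⟩ := hfix (c * σ c) (by simp only [map_mul, ss hc]; ring)
  have r0 : algebraMap F K A * x 0 - W * algebraMap F K C * x 1 - algebraMap F K B * x 2 = 0 := by
    rw [hA, hB, hC]
    linear_combination (a - σ d) * q0 + b * p1 - σ c * p2
  have r1 : algebraMap F K A * x 1 - W * algebraMap F K C * x 2 -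
      algebraMap F K B / W * x 0 = 0 := by
    rw [hA, hB, hC]
    field_simp
    linear_combination W * (a - σ d) * q1 + b * p2 - W * σ c * p0
  have r2 : algebraMap F K A * x 2 - algebraMap F K C * x 0 -
      algebraMap F K B / W * x 1 = 0 := by
    rw [hA, hB, hC]
    field_simp
    linear_combination (a - σ d) * q2 + b * p0 - W * σ c * p1
  have hN : A ^ 3 + w * (-(B / w)) ^ 3 + w ^ 2 * (-C) ^ 3 - 3 * w * A * (-(B / w)) * (-C) = 0 := by
    by_contra hne
    have hne' := (map_ne_zero (algebraMap F K)).2 hne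
    simp only [map_add, map_sub, map_mul, map_pow, map_neg, map_div₀, map_ofNat, ← hW] at hne'
    generalize algebraMap F K A = a' at hne' r0 r1 r2
    generalize algebraMap F K C = c' at hne' r0 r1 r2
    obtain ⟨b', hb'⟩ : ∃ b', b' * W = algebraMap F K B :=
      ⟨algebraMap F K B / W, div_mul_cancel₀ _ hw0⟩
    rw [← hb'] at hne' r0 r1 r2
    rw [mul_div_cancel_right₀ _ hw0] at hne' r1 r2
    apply hx0
    ext i
    apply (mul_eq_zero.1 _).resolve_left hne'
    fin_cases i
    -- The multipliers are entries of the adjugate, so the combination is the determinant times a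
    -- coordinate of `x`.
    · change _ * x 0 = 0
      linear_combination (a' ^ 2 - W * b' * c') * r0 + W * (b' ^ 2 + a' * c') * r1 +
        W * (W * c' ^ 2 + a' * b') * r2
    · change _ * x 1 = 0
      linear_combination (a' ^ 2 - W * b' * c') * r1 + (W * c' ^ 2 + a' * b') * r0 +
        W * (b' ^ 2 + a' * c') * r2
    · change _ * x 2 = 0
      linear_combination (a' ^ 2 - W * b' * c') * r2 + (W * c' ^ 2 + a' * b') * r1 +
        (b' ^ 2 + a' * c') * r0
  obtain ⟨-, hB0, hC0⟩ := cubicNormForm_anisotropic hw hN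
  have hwF : w ≠ 0 := by simpa [hW] using hw0
  have hb0 : b = 0 := by
    have : B = 0 := by simpa [hwF] using hB0
    rw [this, map_zero, eq_comm, mul_eq_zero, map_eq_zero_iff σ σ.injective, or_self] at hB
    exact hB
  have hc0 : c = 0 := by
    have : C = 0 := by simpa using hC0
    rw [this, map_zero, eq_comm, mul_eq_zero, map_eq_zero_iff σ σ.injective, or_self] at hC
    exact hC
  subst hb0 hc0
  refine ⟨d, hd, ?_, by simpa using hcd⟩
  by_contra hne
  have hp : a - σ d ≠ 0 := by
    intro h
    apply hne
    linear_combination h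
  apply hx0
  simp only [map_zero, zero_mul, mul_zero, sub_zero, mul_eq_zero, hp, hw0, false_or,
    map_eq_zero_iff σ σ.injective] at p0 p1 p2
  ext i
  fin_cases i
  · exact p0
  · exact p1
  · exact p2

end Twisted

/-! ### The subspaces attached to the translates of `θ`. -/

section Family

variable {F K : Type*} [Field F] [Field K] [Algebra F K]

/-- The map `x ↦ (σ x₀ + w θ x₂, σ x₁ + θ x₀, σ x₂ + θ x₁)`, applied to `r` blocks in parallel. -/
def twistedMap (σ : K ≃ₐ[F] K) (M : IntermediateField F K) (w : F) (θ : K) (r : ℕ) :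
    (Fin 3 × Fin r → M) →ₗ[F] (Fin (3 * r) → K) where
  toFun x k := σ (x (finProdFinEquiv.symm k)) +
    (if (finProdFinEquiv.symm k).1 = 0 then algebraMap F K w else 1) *
      (θ * x ((finProdFinEquiv.symm k).1 - 1, (finProdFinEquiv.symm k).2))
  map_add' x y := by
    ext k
    simp only [Pi.add_apply, AddMemClass.coe_add, map_add]
    ring
  map_smul' c x := by
    ext k
    simp only [Pi.smul_apply, IntermediateField.coe_smul, map_smul, RingHom.id_apply, smul_add,
      mul_smul_comm]

theorem twistedMap_apply (σ : K ≃ₐ[F] K) (M : IntermediateField F K) (w : F) (θ : K) (r : ℕ)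
    (x : Fin 3 × Fin r → M) (i : Fin 3) (j : Fin r) :
    twistedMap σ M w θ r x (finProdFinEquiv (i, j)) = σ (x (i, j)) +
      (if i = 0 then algebraMap F K w else 1) * (θ * x (i - 1, j)) := by
  change σ (x (finProdFinEquiv.symm (finProdFinEquiv (i, j)))) + _ * (θ * x (_, _)) = _
  rw [Equiv.symm_apply_apply]

variable {σ : K ≃ₐ[F] K} {M : IntermediateField F K} (hMK : finrank M K = 2)
  (hσ : ∀ x ∈ M, σ x ∈ M ∧ σ (σ x) = x) (hfix : ∀ x, σ x = x → ∃ c : F, algebraMap F K c = x)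
  {w : F} (hw : ∀ z : F, z ^ 3 ≠ w) {r : ℕ}

include hMK hσ hfix hw

theorem twistedMap_proportional {θ θ' l : K} (hθ' : θ' ∉ M) {x y : Fin 3 × Fin r → M}
    (hx : x ≠ 0) (h : twistedMap σ M w θ' r y = l • twistedMap σ M w θ r x) :
    ∃ m ∈ M, l = σ m ∧ l * θ = m * θ' := by
  obtain ⟨⟨i, j⟩, hij⟩ := Function.ne_iff.1 hx
  have key : ∀ i, _ := fun i : Fin 3 => congrFun h (finProdFinEquiv (i, j))
  simp only [Pi.smul_apply, twistedMap_apply, smul_eq_mul] at key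
  refine twisted_proportional hMK hσ hfix hw hθ' (x := fun i => x (i, j)) (y := fun i => y (i, j))
    (fun _ => SetLike.coe_mem _) (fun _ => SetLike.coe_mem _) ?_ ?_ ?_ ?_
  · intro h0
    apply hij
    simpa using congrFun h0 i
  · simpa [show (-1 : Fin 3) = 2 from rfl] using key 0
  · simpa using key 1
  · simpa using key 2

theorem twistedMap_injective {θ : K} (hθ : θ ∉ M) :
    Function.Injective (twistedMap σ M w θ r) := by
  rw [injective_iff_map_eq_zero]
  intro x hx
  by_contra hne
  -- A kernel vector is proportional to 0 with any factor; the factor `θ` would then lie in `M`.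
  obtain ⟨m, hm, h1, -⟩ := twistedMap_proportional hMK hσ hfix hw (l := θ) hθ (y := 0) hne
    (by rw [hx, map_zero, smul_zero])
  exact hθ (h1 ▸ (hσ m hm).1)

theorem exists_scalar_of_smul_mem_range_twistedMap {θ : K} (hθ : θ ∉ M) {u : Fin (3 * r) → K}
    (hu : u ∈ LinearMap.range (twistedMap σ M w θ r)) (hu0 : u ≠ 0) {l : K}
    (hl : l • u ∈ LinearMap.range (twistedMap σ M w θ r)) : ∃ c : F, algebraMap F K c = l := by
  obtain ⟨x, rfl⟩ := hu
  obtain ⟨y, hy⟩ := hl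
  have hx : x ≠ 0 := fun h => hu0 (by rw [h, map_zero])
  obtain ⟨m, -, h1, h2⟩ := twistedMap_proportional hMK hσ hfix hw hθ hx hy
  have hθ0 : θ ≠ 0 := fun h => hθ (h ▸ M.zero_mem)
  have := mul_right_cancel₀ hθ0 h2
  exact hfix l (by rw [this, ← h1, this])

theorem eq_of_smul_mem_range_twistedMap {θ : K} (hθ : θ ∉ M) {a b : K} (ha : a ∈ M) (hb : b ∈ M)
    {u : Fin (3 * r) → K} (hu : u ∈ LinearMap.range (twistedMap σ M w (a + θ) r)) (hu0 : u ≠ 0)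
    {l : K} (hl0 : l ≠ 0) (hl : l • u ∈ LinearMap.range (twistedMap σ M w (b + θ) r)) :
    a = b := by
  obtain ⟨x, rfl⟩ := hu
  obtain ⟨y, hy⟩ := hl
  have hx : x ≠ 0 := fun h => hu0 (by rw [h, map_zero])
  have hθ' : b + θ ∉ M := fun h => hθ (by simpa using M.sub_mem h hb)
  obtain ⟨m, hm, h1, h2⟩ := twistedMap_proportional hMK hσ hfix hw hθ' hx hy
  have hlM : l ∈ M := h1 ▸ (hσ m hm).1
  obtain ⟨h3, h4⟩ := eq_and_eq_of_add_mul_eq hθ (M.mul_mem hlM ha) hlM (M.mul_mem hm hb) hm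
    (by linear_combination h2)
  subst h4
  exact mul_left_cancel₀ hl0 h3

end Family

/-! ### From scalar multiples to weights and disjointness. -/

section Criteria

variable {F : Type*} (K : Type*) [Field F] [Field K]
variable {V : Type*} [AddCommGroup V] [Module K V] [Module F V]

theorem isScattered_of_smul_mem [Algebra F K] [IsScalarTower F K V] (U : Submodule F V)
    (h : ∀ u ∈ U, u ≠ 0 → ∀ l : K, l • u ∈ U → ∃ c : F, algebraMap F K c = l) :
    IsScattered K U := by
  intro P
  by_cases h0 : ∃ u ∈ U ⊓ P.submodule.restrictScalars F, u ≠ 0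
  · obtain ⟨u, ⟨hu, huP⟩, hu0⟩ := h0
    refine finrank_le_one (⟨u, hu, huP⟩ : ↥(U ⊓ P.submodule.restrictScalars F)) ?_
    rintro ⟨v, hv, hvP⟩
    have hP : P.submodule = Submodule.span K {u} := by
      rw [Projectivization.submodule_eq] at huP ⊢
      obtain ⟨a, rfl⟩ := Submodule.mem_span_singleton.1 huP
      have ha : a ≠ 0 := fun h => hu0 (by rw [h, zero_smul])
      rw [Submodule.span_singleton_smul_eq ha.isUnit]
    have hv' : v ∈ P.submodule := hvP
    rw [hP] at hv'
    obtain ⟨l, rfl⟩ := Submodule.mem_span_singleton.1 hv'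
    obtain ⟨c, rfl⟩ := h u hu hu0 l hv
    exact ⟨c, Subtype.ext (algebraMap_smul K c u).symm⟩
  · push Not at h0
    have : U ⊓ P.submodule.restrictScalars F = ⊥ := (Submodule.eq_bot_iff _).2 h0
    rw [pointWeight, this, finrank_bot]
    exact Nat.zero_le _

theorem disjoint_linearSet_of_smul_mem (U W : Submodule F V)
    (h : ∀ u ∈ U, u ≠ 0 → ∀ l : K, l ≠ 0 → l • u ∉ W) :
    Disjoint (linearSet K U) (linearSet K W) := by
  rw [Set.disjoint_left]
  rintro P ⟨u, hu0, hu, rfl⟩ ⟨v, hv0, hv, huv⟩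
  obtain ⟨a, ha⟩ := (Projectivization.mk_eq_mk_iff K v u hv0 hu0).1 huv.symm
  exact h u hu hu0 a a.ne_zero (by rw [← Units.smul_def, ha]; exact hv)

end Criteria

theorem exists_disjoint_scattered {F K : Type*} [Field F] [Finite F] [Field K] [Algebra F K]
    (hK : finrank F K = 4) (hmod : Nat.card F ≡ 1 [MOD 3]) (r : ℕ) :
    ∃ U : Fin (2 * (Nat.card F - 1)) → Submodule F (Fin (3 * r) → K),
      (∀ i, finrank F (U i) = 6 * r ∧
        ∀ u ∈ U i, u ≠ 0 → ∀ l : K, l • u ∈ U i → ∃ c : F, algebraMap F K c = l) ∧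
      ∀ i j, i ≠ j → ∀ u ∈ U i, u ≠ 0 → ∀ l : K, l ≠ 0 → l • u ∉ U j := by
  obtain ⟨w, hw⟩ := exists_not_cube hmod
  obtain ⟨σ, M, hFM, hMK, hσ, hfix⟩ := exists_generator_and_quadratic_subfield F K hK
  have : FiniteDimensional F M := FiniteDimensional.of_finrank_pos (by omega)
  have : Finite M := Module.finite_of_finite F
  obtain ⟨θ, hθ⟩ : ∃ θ : K, θ ∉ M := by
    by_contra! h
    have htop : M = ⊤ := eq_top_iff.2 fun x _ => h x
    rw [htop, IntermediateField.finrank_top] at hMK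
    omega
  have hcard : Nat.card (Fin (2 * (Nat.card F - 1))) ≤ Nat.card M := by
    rw [Module.natCard_eq_pow_finrank (K := F) (V := M), hFM, Nat.card_fin]
    have : 0 < Nat.card F := Nat.card_pos
    obtain ⟨k, hk⟩ : ∃ k, Nat.card F = k + 1 := ⟨_, (Nat.succ_pred_eq_of_pos this).symm⟩
    rw [hk, Nat.add_sub_cancel]
    nlinarith
  obtain ⟨f⟩ : Nonempty (Fin (2 * (Nat.card F - 1)) ↪ M) := by
    have := Fintype.ofFinite M
    apply Function.Embedding.nonempty_of_card_le
    simpa only [Nat.card_eq_fintype_card] using hcard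
  have hfθ : ∀ i, (f i : K) + θ ∉ M := fun i h => hθ (by simpa using M.sub_mem h (f i).2)
  refine ⟨fun i => LinearMap.range (twistedMap σ M w (f i + θ) r), fun i => ⟨?_, ?_⟩, ?_⟩
  · rw [LinearMap.finrank_range_of_inj (twistedMap_injective hMK hσ hfix hw (hfθ i)),
      finrank_pi_fintype]
    simp [hFM]
    ring
  · intro u hu hu0 l
    exact exists_scalar_of_smul_mem_range_twistedMap hMK hσ hfix hw (hfθ i) hu hu0
  · intro i j hij u hu hu0 l hl hlu
    exact hij (f.injective (Subtype.ext (eq_of_smul_mem_range_twistedMap hMK hσ hfix hw hθ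
      (f i).2 (f j).2 hu hu0 hl hlu)))

/-! ### Trace duality and the MSRD codes. -/

noncomputable section

section Dual

variable (F K : Type*) [Field F] [Field K] [Algebra F K]

/-- The `F`-bilinear form `(v, h) ↦ Tr (v ⬝ h)` on `K ^ N`. -/
def traceDot (N : ℕ) : LinearMap.BilinForm F (Fin N → K) :=
  LinearMap.mk₂ F (fun v h => Algebra.trace F K (v ⬝ᵥ h))
    (fun _ _ _ => by rw [add_dotProduct, map_add])
    (fun _ _ _ => by rw [smul_dotProduct, map_smul])
    (fun _ _ _ => by rw [dotProduct_add, map_add])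
    (fun _ _ _ => by rw [dotProduct_smul, map_smul])

variable {F K} {N : ℕ}

theorem traceDot_apply (v h : Fin N → K) :
    traceDot F K N v h = Algebra.trace F K (v ⬝ᵥ h) := rfl

theorem traceDot_isSymm : (traceDot F K N).IsSymm :=
  ⟨fun v h => by simp only [traceDot_apply, dotProduct_comm v h]⟩

theorem traceDot_nondegenerate [FiniteDimensional F K] [Algebra.IsSeparable F K] :
    (traceDot F K N).Nondegenerate := by
  refine (LinearMap.IsRefl.nondegenerate_iff_separatingLeft
    (traceDot_isSymm (F := F) (K := K)).isRefl).2 ?_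
  intro v hv
  ext k
  refine (traceForm_nondegenerate F K).1 (v k) fun l => ?_
  have := hv (Pi.single k l)
  rwa [traceDot_apply, dotProduct_single] at this

/-- The `F`-linear map `v ↦ v ⬝ h`. -/
def dotMap (F : Type*) {K : Type*} [Field F] [Field K] [Algebra F K] {N : ℕ} (h : Fin N → K) :
    (Fin N → K) →ₗ[F] K where
  toFun v := v ⬝ᵥ h
  map_add' v w := add_dotProduct v w h
  map_smul' c v := smul_dotProduct c v h

/-- The scalars `l` with `l h ∈ U`. -/
def scalarsInto (U : Submodule F (Fin N → K)) (h : Fin N → K) : Submodule F K :=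
  U.comap ((LinearMap.toSpanSingleton K (Fin N → K) h).restrictScalars F)

theorem mem_scalarsInto {U : Submodule F (Fin N → K)} {h : Fin N → K} {l : K} :
    l ∈ scalarsInto U h ↔ l • h ∈ U := Iff.rfl

/-- Since `Tr ((v ⬝ h) l) = Tr (v ⬝ (l h))`, double orthogonality identifies the trace-orthogonal of
the image of `U^⊥` with the scalars taking `h` into `U`. -/
theorem finrank_map_dotMap_add [FiniteDimensional F K] [Algebra.IsSeparable F K]
    (U : Submodule F (Fin N → K)) (h : Fin N → K) :
    finrank F (((traceDot F K N).orthogonal U).map (dotMap F h)) + finrank F (scalarsInto U h) =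
      finrank F K := by
  have horth : (Algebra.traceForm F K).orthogonal
      (((traceDot F K N).orthogonal U).map (dotMap F h)) = scalarsInto U h := by
    ext l
    have hU := SetLike.ext_iff.1 (LinearMap.BilinForm.orthogonal_orthogonal
      (traceDot_nondegenerate (F := F)) traceDot_isSymm.isRefl U) (l • h)
    rw [mem_scalarsInto, ← hU,
      LinearMap.BilinForm.mem_orthogonal_iff, LinearMap.BilinForm.mem_orthogonal_iff]
    have key : ∀ v : Fin N → K, Algebra.traceForm F K (dotMap F h v) l =
        traceDot F K N v (l • h) := by
      intro v
      rw [Algebra.traceForm_apply, traceDot_apply, dotProduct_smul, smul_eq_mul, mul_comm]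
      rfl
    constructor
    · intro H v hv
      exact (key v).symm.trans (H _ (Submodule.mem_map_of_mem hv))
    · rintro H _ ⟨v, hv, rfl⟩
      exact (key v).trans (H v hv)
  rw [← horth, LinearMap.BilinForm.finrank_orthogonal (traceForm_nondegenerate F K)]
  have := Submodule.finrank_le (((traceDot F K N).orthogonal U).map (dotMap F h))
  omega

theorem vectorRank_zero (n : ℕ) : vectorRank F (0 : Fin n → K) = 0 := by
  have : Submodule.span F (Set.range (0 : Fin n → K)) = ⊥ := by
    rw [Submodule.span_eq_bot]
    rintro _ ⟨_, rfl⟩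
    rfl
  rw [vectorRank, this, finrank_bot]

theorem vectorRank_dotProduct_basis {n : ℕ} (W : Submodule F (Fin N → K)) (b : Basis (Fin n) F W)
    (h : Fin N → K) :
    vectorRank F (fun l => (b l : Fin N → K) ⬝ᵥ h) = finrank F (W.map (dotMap F h)) := by
  have hspan : W.map (dotMap F h) = Submodule.span F (Set.range fun l => (b l : Fin N → K) ⬝ᵥ h) :=
    calc W.map (dotMap F h) = (Submodule.map W.subtype ⊤).map (dotMap F h) := by
          rw [Submodule.map_subtype_top]
      _ = _ := by
          rw [← b.span_eq, Submodule.map_span, Submodule.map_span, ← Set.range_comp,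
            ← Set.range_comp]
          rfl
  rw [hspan, vectorRank]

theorem vectorRank_dotProduct_add [FiniteDimensional F K] [Algebra.IsSeparable F K]
    (U : Submodule F (Fin N → K)) {n : ℕ} (b : Basis (Fin n) F ((traceDot F K N).orthogonal U))
    (h : Fin N → K) :
    vectorRank F (fun l => (b l : Fin N → K) ⬝ᵥ h) + finrank F (scalarsInto U h) =
      finrank F K := by
  rw [vectorRank_dotProduct_basis, finrank_map_dotMap_add]

/-- The point spanned by `h` lies in at most one of the disjoint linear sets, and has weight at most
one there. -/
theorem sum_finrank_scalarsInto_le_one {t : ℕ} (U : Fin t → Submodule F (Fin N → K))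
    (hs : ∀ i, ∀ u ∈ U i, u ≠ 0 → ∀ l : K, l • u ∈ U i → ∃ c : F, algebraMap F K c = l)
    (hd : ∀ i j, i ≠ j → ∀ u ∈ U i, u ≠ 0 → ∀ l : K, l ≠ 0 → l • u ∉ U j)
    {h : Fin N → K} (hh : h ≠ 0) : ∑ i, finrank F (scalarsInto (U i) h) ≤ 1 := by
  by_cases hex : ∃ i, ∃ l : K, l ≠ 0 ∧ l • h ∈ U i
  · obtain ⟨i, l, hl0, hl⟩ := hex
    have hlh : l • h ≠ 0 := smul_ne_zero hl0 hh
    have hdiv : ∀ m : K, (m / l) • l • h = m • h := fun m => by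
      rw [smul_smul, div_mul_cancel₀ _ hl0]
    rw [Finset.sum_eq_single i]
    · refine finrank_le_one (⟨l, hl⟩ : scalarsInto (U i) h) ?_
      rintro ⟨m, hm⟩
      obtain ⟨c, hc⟩ := hs i _ hl hlh (m / l) (by rw [hdiv]; exact hm)
      refine ⟨c, Subtype.ext ?_⟩
      change c • l = m
      rw [Algebra.smul_def, hc, div_mul_cancel₀ _ hl0]
    · intro j _ hji
      have : scalarsInto (U j) h = ⊥ := by
        refine (Submodule.eq_bot_iff _).2 fun m hm => ?_
        by_contra hm0
        exact hd i j hji.symm _ hl hlh (m / l) (div_ne_zero hm0 hl0) (by rw [hdiv]; exact hm)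
      rw [this, finrank_bot]
    · simp
  · push Not at hex
    rw [Finset.sum_eq_zero]
    · exact Nat.zero_le 1
    · intro i _
      have : scalarsInto (U i) h = ⊥ := by
        refine (Submodule.eq_bot_iff _).2 fun m hm => ?_
        by_contra hm0
        exact hex i m hm0 hm
      rw [this, finrank_bot]

/-- The evaluation code defined by vectors `b i l ∈ K ^ N`. -/
def evaluationMap {t n : ℕ} (b : Fin t → Fin n → Fin N → K) :
    (Fin N → K) →ₗ[K] (Fin t → Fin n → K) where
  toFun h i l := b i l ⬝ᵥ h
  map_add' v w := by ext i l; exact dotProduct_add _ v w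
  map_smul' c v := by ext i l; exact dotProduct_smul c _ v

theorem exists_msrd_of_disjoint_scattered [Finite F] (hK : finrank F K = 4) {r t : ℕ}
    (hr : 1 ≤ r) (ht : 1 ≤ t) (U : Fin t → Submodule F (Fin (3 * r) → K))
    (hU : ∀ i, finrank F (U i) = 6 * r)
    (hs : ∀ i, ∀ u ∈ U i, u ≠ 0 → ∀ l : K, l • u ∈ U i → ∃ c : F, algebraMap F K c = l)
    (hd : ∀ i j, i ≠ j → ∀ u ∈ U i, u ≠ 0 → ∀ l : K, l ≠ 0 → l • u ∉ U j) :
    ∃ C : Submodule K (Fin t → Fin (6 * r) → K),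
      finrank K C = 3 * r ∧ IsMSRD F (n := fun _ => 6 * r) C := by
  have : FiniteDimensional F K := FiniteDimensional.of_finrank_pos (by omega)
  have hrank : ∀ i, finrank F ((traceDot F K (3 * r)).orthogonal (U i)) = 6 * r := by
    intro i
    rw [LinearMap.BilinForm.finrank_orthogonal traceDot_nondegenerate, hU, finrank_pi_fintype]
    simp [hK]
    omega
  let b := fun i => finBasisOfFinrankEq F _ (hrank i)
  let φ := evaluationMap fun i l => (b i l : Fin (3 * r) → K)
  have hweight : ∀ h, ∑ i, vectorRank F (φ h i) + ∑ i, finrank F (scalarsInto (U i) h) =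
      4 * t := by
    intro h
    have : ∀ i, vectorRank F (φ h i) + finrank F (scalarsInto (U i) h) = finrank F K :=
      fun i => vectorRank_dotProduct_add (U i) (b i) h
    rw [← Finset.sum_add_distrib, Finset.sum_congr rfl fun i _ => this i, hK]
    simp [mul_comm]
  have hlow : ∀ h ≠ 0, 4 * t - 1 ≤ ∑ i, vectorRank F (φ h i) := by
    intro h hh
    have h1 := sum_finrank_scalarsInto_le_one U hs hd hh
    have h2 := hweight h
    omega
  have hinj : Function.Injective φ := by
    rw [injective_iff_map_eq_zero]
    intro h hφ
    by_contra hh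
    have h1 := hlow h hh
    simp only [hφ, Pi.zero_apply] at h1
    simp only [vectorRank_zero, Finset.sum_const_zero] at h1
    omega
  have hCK : finrank K (LinearMap.range φ) = 3 * r := by
    rw [LinearMap.finrank_range_of_inj hinj, finrank_fin_fun]
  refine ⟨LinearMap.range φ, hCK, fun _ _ _ => le_rfl, 4 * t - 1, ⟨?_, ?_⟩, ?_⟩
  -- The minimum is attained at a nonzero `h` in one of the subspaces, where the scalar 1 makes the
  -- defect positive.
  · let i0 : Fin t := ⟨0, ht⟩
    obtain ⟨h, hh0⟩ : ∃ h : U i0, h ≠ 0 := by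
      have : Nontrivial (U i0) := nontrivial_of_finrank_pos (R := F) (by rw [hU]; omega)
      exact exists_ne 0
    have hh : (h : Fin (3 * r) → K) ≠ 0 := fun H => hh0 (Subtype.ext H)
    refine ⟨φ h, ⟨h, rfl⟩, 0, Submodule.zero_mem _, fun H => hh (hinj (by rw [H, map_zero])), ?_⟩
    have h1 := hlow h hh
    have h2 := hweight h
    have h3 : 0 < finrank F (scalarsInto (U i0) (h : Fin (3 * r) → K)) := by
      have : Nontrivial (scalarsInto (U i0) (h : Fin (3 * r) → K)) :=
        ⟨⟨1, by rw [mem_scalarsInto, one_smul]; exact h.2⟩, 0, fun H =>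
          one_ne_zero (congrArg Subtype.val H)⟩
      exact finrank_pos
    have h4 := Finset.single_le_sum (f := fun i => finrank F (scalarsInto (U i) (h : Fin (3 * r) → K)))
      (fun _ _ => Nat.zero_le _) (Finset.mem_univ i0)
    simp only [sumRankDist, Pi.zero_apply, sub_zero]
    omega
  · rintro e ⟨_, ⟨h, rfl⟩, _, ⟨h', rfl⟩, hne, rfl⟩
    have h1 := hlow (h - h') (sub_ne_zero.2 fun H => hne (by rw [H]))
    rw [map_sub] at h1
    exact h1
  · have h4 : min 4 (6 * r) = 4 := by omega
    have h6 : max 4 (6 * r) = 6 * r := by omega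
    -- `d - 1 = 4(t - 1) + 2`, so `j` is the last block and `δ = 2`; the sizes agree because `12r +
    -- 6r * 2 = 4 * 6r`.
    refine ⟨⟨t - 1, by omega⟩, 2, ?_, ?_, ?_⟩
    · simp only [hK, h4, Finset.sum_const, Fin.card_Iio, smul_eq_mul]
      omega
    · rw [hK, h4]
      norm_num
    · have : Finite K := Module.finite_of_finite F
      have hF : finrank F (LinearMap.range φ) = 12 * r := by
        rw [← finrank_mul_finrank F K, hK, hCK]
        ring
      rw [Module.natCard_eq_pow_finrank (K := F) (V := LinearMap.range φ), hF, hK, h6, ← pow_add]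
      simp only [Finset.sum_const, Fin.card_Ici, smul_eq_mul]
      congr 1
      have : t - (t - 1) = 1 := by omega
      rw [this]
      ring

end Dual

end

theorem mainTheorem4 {F K : Type*} [Field F] [Finite F] [Field K] [Algebra F K]
    (q : ℕ) (hq : Nat.card F = q) (hK : Module.finrank F K = 4)
    (hodd : Odd q) (hmod : q ≡ 1 [MOD 3]) :
    (∃ U : Fin (2 * (q - 1)) → Submodule F (Fin 3 → K),
      (∀ i, IsMaximumScattered K (U i) ∧ Module.finrank F (U i) = 6) ∧
      ∀ i j, i ≠ j → Disjoint (linearSet K (U i)) (linearSet K (U j))) ∧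
    (∀ r : ℕ, 1 ≤ r → ∃ U : Fin (2 * (q - 1)) → Submodule F (Fin (3 * r) → K),
      (∀ i, IsMaximumScattered K (U i) ∧ Module.finrank F (U i) = 6 * r) ∧
      ∀ i j, i ≠ j → Disjoint (linearSet K (U i)) (linearSet K (U j))) ∧
    (∀ r : ℕ, 1 ≤ r → ∀ t : ℕ, 1 ≤ t → t ≤ 2 * (q - 1) →
      ∃ C : Submodule K (Fin t → Fin (6 * r) → K),
        Module.finrank K C = 3 * r ∧ IsMSRD F (n := fun _ => 6 * r) C) := by
  subst hq
  have h2 : ∀ r : ℕ, 1 ≤ r → ∃ U : Fin (2 * (Nat.card F - 1)) → Submodule F (Fin (3 * r) → K),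
      (∀ i, IsMaximumScattered K (U i) ∧ Module.finrank F (U i) = 6 * r) ∧
      ∀ i j, i ≠ j → Disjoint (linearSet K (U i)) (linearSet K (U j)) := by
    intro r _
    obtain ⟨U, hU, hd⟩ := exists_disjoint_scattered hK hmod r
    refine ⟨U, fun i => ⟨⟨isScattered_of_smul_mem K _ (hU i).2, ?_⟩, (hU i).1⟩, fun i j hij =>
      disjoint_linearSet_of_smul_mem K _ _ (hd i j hij)⟩
    rw [(hU i).1, hK, finrank_fin_fun]
    ring
  refine ⟨h2 1 le_rfl, h2, fun r hr t ht htq => ?_⟩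
  obtain ⟨U, hU, hd⟩ := exists_disjoint_scattered hK hmod r
  exact exists_msrd_of_disjoint_scattered hK hr ht (fun i => U (Fin.castLE htq i))
    (fun i => (hU _).1) (fun i => (hU _).2)
    fun i j hij => hd _ _ fun h => hij (Fin.castLE_injective htq h)
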